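/- For every $\varepsilon>0$ there is a constant $C>0$, depending only on $\varepsilon$, such that the following holds. Let $G$ be a simple undirected graph with $N\ge 1$ vertices, let $L=D-A$ be its Laplacian matrix ($D$ the diagonal matrix of vertex degrees, $A$ the adjacency matrix), let $\lambda_N$ be the largest eigenvalue of $L$, and let $t\ge 0$. Let the vertices of $G$ be labelled, in an arbitrary injective way, by computational basis states of $n=\lceil\log_2 N\rceil$ qubits, and let $E$ be the isometry that maps each vertex to its basis state (if $N=2^n$, $E$ is a permutation matrix that identifies the vertices with all the basis states). Call a one-qubit unitary or a CNOT an elementary gate. Then the continuous-time quantum walk $e^{iLt}$ can be simulated within error $\varepsilon$ by a quantum circuit on these $n$ qubits (without ancillas) with $$C(e^{iLt})\;\le\; C\,\lambda_N\, t\, N^4\log N$$ elementary gates; that is, there is a product $W$ of at most that many elementary gates with $\|WE-E\,e^{iLt}\|\le\varepsilon$ in the spectral norm (if $N=2^n$, this is $\|W-E e^{iLt}E^{-1}\|\le\varepsilon$). In short, $O(\lambda_N t N^4\log N)$ elementary gates suffice for constant error. -/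

import Mathlib

namespace CTQW

/-- The labels of the computational basis states of `n` qubits. -/
abbrev Basis (n : ℕ) : Type := Fin n → Fin 2

/-- Elementary gates on `n` qubits: an arbitrary unitary on one qubit, or a CNOT with distinct
control and target qubits. -/
inductive Gate (n : ℕ) : Type where
  | single (q : Fin n) (u : Matrix.unitaryGroup (Fin 2) ℂ) : Gate n
  | cnot (c t : Fin n) (hct : c ≠ t) : Gate n

/-- The matrix of a gate on the whole space of `n` qubits (the entry `x y` is `⟨x| g |y⟩`).
A single-qubit gate acts as the identity on the other qubits; the CNOT gate maps `|y⟩` to the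
basis state in which bit `t` of `y` is replaced by the sum mod 2 of the bits `t` and `c`. -/
def Gate.toMatrix {n : ℕ} : Gate n → Matrix (Basis n) (Basis n) ℂ
  | .single q u => Matrix.of fun x y =>
      if ∀ j, j ≠ q → x j = y j then (u : Matrix (Fin 2) (Fin 2) ℂ) (x q) (y q) else 0
  | .cnot c t _ => Matrix.of fun x y =>
      if x = Function.update y t (y t + y c) then 1 else 0

/-- A circuit without ancillas: the list of its gates in the order in which they are applied.
The number of elementary gates of a circuit is the length of the list. -/
abbrev Circuit (n : ℕ) : Type := List (Gate n)

/-- The unitary matrix implemented by a circuit. -/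
def Circuit.toMatrix {n : ℕ} : Circuit n → Matrix (Basis n) (Basis n) ℂ
  | [] => 1
  | g :: gs => Circuit.toMatrix gs * g.toMatrix

/-- The spectral norm of a complex matrix: its operator norm for the Euclidean norms. -/
noncomputable def specNorm {m k : Type*} [Fintype m] [Fintype k] [DecidableEq k]
    (A : Matrix m k ℂ) : ℝ :=
  ‖LinearMap.toContinuousLinearMap (Matrix.toEuclideanLin A)‖

/-- The continuous-time quantum walk operator `e^{iLt}`, where `L = D - A` is the Laplacian
matrix of the graph `G`. -/
noncomputable def walk {V : Type*} [Fintype V] [DecidableEq V] (G : SimpleGraph V)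
    [DecidableRel G.Adj] (t : ℝ) : Matrix V V ℂ :=
  NormedSpace.exp ((Complex.I * (t : ℂ)) • G.lapMatrix ℂ)

/-- The isometry `|v⟩ ↦ |e v⟩` that encodes the vertices as computational basis states
(a permutation matrix if `e` is a bijection). -/
def encode {V : Type*} {n : ℕ} (e : V ↪ Basis n) : Matrix (Basis n) V ℂ :=
  Matrix.of fun x v => if x = e v then 1 else 0

/-- The circuit `c` simulates the operator `U` on the encoded vertices within error `ε`:
`‖c|e ψ⟩ - |e (U ψ)⟩‖ ≤ ε ‖ψ‖` for all `ψ`. If `e` is a bijection, this is the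
spectral-norm distance of the two operators, written in the same basis. -/
def Simulates {V : Type*} [Fintype V] [DecidableEq V] {n : ℕ} (e : V ↪ Basis n)
    (c : Circuit n) (U : Matrix V V ℂ) (ε : ℝ) : Prop :=
  specNorm (Circuit.toMatrix c * encode e - encode e * U) ≤ ε

end CTQW

/-!
The bound has a factor `λ t`, so only two cases matter. All eigenvalues `μ` of the Laplacian lie in
`[0, λ]` and `|1 - e^{iμt}| ≤ μ t`, so for `λ t ≤ ε` the empty circuit is accurate enough
(`simulates_nil`). For `λ t > ε` the bound with `C = 304 / ε` is at least `304 N^4 log N`, which is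
enough for a circuit that implements the walk operator exactly, whatever `t` is
(`exists_simulates_exact`, `card_mul_phaseCost_le`). In that case `λ ≠ 0`, hence `N ≥ 2`.

For the exact implementation let `u_j` be the orthonormal eigenvectors and `μ_j` the eigenvalues.
Then `W = ∏_j (1 + (e^{iμ_j t} - 1) |E u_j⟩⟨E u_j|)` satisfies `W E = E e^{iLt}`. Each factor is a
phase on a one-dimensional subspace: map the state `E u_j` to a multiple of `|0⟩`, apply a phase to
`|0⟩`, and go back (`implementable_rankOne`). Two facts supply the circuits.

* Every diagonal unitary is a product of `2^n` parity phases `exp(i a χ_S)`, by the expansion of the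
  exponents in the characters `χ_S` of `(ℤ/2)^n`; each of them is a single-qubit phase conjugated by
  CNOTs (`implementable_diagonal`).
* A state is mapped to `|0⟩` by clearing one bit after another. Clearing bit `q` is a rotation of
  qubit `q` controlled by all other qubits, and it is realized by two gates on qubit `q` with one
  diagonal unitary between them (`exists_implementable_clear_bit`).

With `2^n ≤ 2N` the total number of gates is `O(n² N 2^n) = O(N^4 log N)`.
-/

namespace CTQW
open Matrix

variable {n : ℕ}

/-! ### Gates and circuits -/

lemma single_mulVec (q : Fin n) (u : Matrix.unitaryGroup (Fin 2) ℂ) (v : Basis n → ℂ)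
    (x : Basis n) :
    ((Gate.single q u).toMatrix *ᵥ v) x =
      ∑ b, (u : Matrix (Fin 2) (Fin 2) ℂ) (x q) b * v (Function.update x q b) := by
  simp only [Matrix.mulVec, dotProduct, Gate.toMatrix, Matrix.of_apply, ite_mul, zero_mul]
  rw [← Finset.sum_filter]
  refine Finset.sum_nbij' (fun y => y q) (fun b => Function.update x q b) ?_ ?_ ?_ ?_ ?_
  · simp
  · intro b _
    simp only [Finset.mem_filter, Finset.mem_univ, true_and]
    intro j hj
    simp [hj]
  · intro y hy
    simp only [Finset.mem_filter, Finset.mem_univ, true_and] at hy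
    funext j
    by_cases hj : j = q
    · subst hj; simp
    · simp [hj, hy j hj]
  · simp
  · intro y hy
    simp only [Finset.mem_filter, Finset.mem_univ, true_and] at hy
    congr 2
    funext j
    by_cases hj : j = q
    · subst hj; simp
    · simp [hj, hy j hj]

/-- The map of basis states computed by a CNOT is an involution. -/
lemma eq_update_add_iff {c t : Fin n} (hct : c ≠ t) (x y : Basis n) :
    x = Function.update y t (y t + y c) ↔ y = Function.update x t (x t + x c) := by
  have aux : ∀ y : Basis n, Function.update (Function.update y t (y t + y c)) t
      ((Function.update y t (y t + y c)) t + (Function.update y t (y t + y c)) c) = y := by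
    intro y
    funext j
    by_cases hj : j = t
    · subst hj
      have h2 : ∀ a b : Fin 2, a + b + b = a := by decide
      simp [hct, h2]
    · simp [hj]
  constructor
  · rintro rfl; exact (aux y).symm
  · rintro rfl; exact (aux x).symm

lemma cnot_mulVec (c t : Fin n) (hct : c ≠ t) (v : Basis n → ℂ) (x : Basis n) :
    ((Gate.cnot c t hct).toMatrix *ᵥ v) x = v (Function.update x t (x t + x c)) := by
  simp only [Matrix.mulVec, dotProduct, Gate.toMatrix, Matrix.of_apply, ite_mul, zero_mul, one_mul,
    eq_update_add_iff hct x]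
  simp

lemma single_mul_single (q : Fin n) (u w : Matrix.unitaryGroup (Fin 2) ℂ) :
    (Gate.single q u).toMatrix * (Gate.single q w).toMatrix = (Gate.single q (u * w)).toMatrix := by
  refine Matrix.ext_of_mulVec_single fun y => ?_
  rw [← Matrix.mulVec_mulVec]
  funext x
  simp only [single_mulVec]
  simp [Matrix.mul_apply]
  ring

lemma single_one (q : Fin n) : (Gate.single q 1).toMatrix = 1 := by
  refine Matrix.ext_of_mulVec_single fun y => ?_
  funext x
  simp [single_mulVec, -mulVec_single, Matrix.one_apply]

lemma cnot_mul_self (c t : Fin n) (hct : c ≠ t) :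
    (Gate.cnot c t hct).toMatrix * (Gate.cnot c t hct).toMatrix = 1 := by
  refine Matrix.ext_of_mulVec_single fun y => ?_
  rw [← Matrix.mulVec_mulVec]
  funext x
  rw [cnot_mulVec, cnot_mulVec, ← (eq_update_add_iff hct _ x).1 rfl, one_mulVec]

lemma single_conjTranspose (q : Fin n) (u : Matrix.unitaryGroup (Fin 2) ℂ) :
    (Gate.single q u).toMatrixᴴ = (Gate.single q u⁻¹).toMatrix := by
  ext x y
  simp only [Gate.toMatrix, conjTranspose_apply, of_apply, apply_ite star, star_zero,
    Matrix.UnitaryGroup.inv_val, Matrix.star_apply]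
  exact if_congr ⟨fun h j hj => (h j hj).symm, fun h j hj => (h j hj).symm⟩ rfl rfl

lemma cnot_conjTranspose (c t : Fin n) (hct : c ≠ t) :
    (Gate.cnot c t hct).toMatrixᴴ = (Gate.cnot c t hct).toMatrix := by
  ext x y
  simp only [Gate.toMatrix, conjTranspose_apply, of_apply, apply_ite star, star_zero, star_one,
    eq_update_add_iff hct x y]

/-- `Implementable k M`: some circuit of at most `k` elementary gates has the matrix `M`. -/
def Implementable (k : ℕ) (M : Matrix (Basis n) (Basis n) ℂ) : Prop :=
  ∃ c : Circuit n, c.toMatrix = M ∧ c.length ≤ k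

lemma toMatrix_append (c d : Circuit n) :
    Circuit.toMatrix (c ++ d) = Circuit.toMatrix d * Circuit.toMatrix c := by
  induction c with
  | nil => simp [Circuit.toMatrix]
  | cons g c ih => simp [Circuit.toMatrix, ih, Matrix.mul_assoc]

lemma Implementable.one : Implementable 0 (1 : Matrix (Basis n) (Basis n) ℂ) :=
  ⟨[], rfl, le_rfl⟩

lemma Implementable.gate (g : Gate n) : Implementable 1 g.toMatrix :=
  ⟨[g], by simp [Circuit.toMatrix], le_rfl⟩

lemma Implementable.mul {k l : ℕ} {A B : Matrix (Basis n) (Basis n) ℂ}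
    (hA : Implementable k A) (hB : Implementable l B) : Implementable (k + l) (A * B) := by
  obtain ⟨c, rfl, hc⟩ := hA
  obtain ⟨d, rfl, hd⟩ := hB
  exact ⟨d ++ c, toMatrix_append d c, by simp; omega⟩

lemma Implementable.mono {k l : ℕ} {A : Matrix (Basis n) (Basis n) ℂ}
    (hA : Implementable k A) (h : k ≤ l) : Implementable l A := by
  obtain ⟨c, rfl, hc⟩ := hA
  exact ⟨c, rfl, hc.trans h⟩

/-- Circuits are unitary, and the reversed circuit of inverse gates implements the adjoint. -/
lemma Implementable.adjoint {k : ℕ} {A : Matrix (Basis n) (Basis n) ℂ} (hA : Implementable k A) :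
    Aᴴ * A = 1 ∧ Implementable k Aᴴ := by
  obtain ⟨c, rfl, hc⟩ := hA
  induction c generalizing k with
  | nil => exact ⟨by simp [Circuit.toMatrix], by
      simpa [Circuit.toMatrix] using Implementable.one.mono (Nat.zero_le k)⟩
  | cons g c ih =>
    obtain ⟨h1, h2⟩ := ih (k := c.length) le_rfl
    have hg : g.toMatrixᴴ * g.toMatrix = 1 ∧ Implementable 1 g.toMatrixᴴ := by
      cases g with
      | single q u =>
        rw [single_conjTranspose, single_mul_single, inv_mul_cancel, single_one]
        exact ⟨rfl, .gate _⟩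
      | cnot c t hct =>
        rw [cnot_conjTranspose, cnot_mul_self]
        exact ⟨rfl, .gate _⟩
    simp only [Circuit.toMatrix, conjTranspose_mul]
    refine ⟨?_, (hg.2.mul h2).mono (by simp at hc; omega)⟩
    rw [Matrix.mul_assoc, ← Matrix.mul_assoc (Circuit.toMatrix c)ᴴ, h1, Matrix.one_mul, hg.1]

/-! ### Diagonal unitaries -/

/-- The single-qubit unitary `diag(d 0, d 1)`. -/
noncomputable def diagUnitary (d : Fin 2 → ℂ) (hd : ∀ b, ‖d b‖ = 1) :
    Matrix.unitaryGroup (Fin 2) ℂ :=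
  ⟨diagonal d, by
    rw [Matrix.mem_unitaryGroup_iff', star_eq_conjTranspose, diagonal_conjTranspose,
      diagonal_mul_diagonal, ← diagonal_one]
    congr 1
    funext b
    simpa [hd] using Complex.conj_mul' (d b)⟩

lemma single_diagUnitary (q : Fin n) (d : Fin 2 → ℂ) (hd : ∀ b, ‖d b‖ = 1) :
    (Gate.single q (diagUnitary d hd)).toMatrix = diagonal fun x => d (x q) := by
  refine Matrix.ext_of_mulVec_single fun y => ?_
  funext x
  rw [single_mulVec, mulVec_diagonal]
  simp [diagUnitary, diagonal_apply]

lemma cnot_mul_diagonal_mul_cnot (c t : Fin n) (hct : c ≠ t) (f : Basis n → ℂ) :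
    (Gate.cnot c t hct).toMatrix * diagonal f * (Gate.cnot c t hct).toMatrix =
      diagonal fun x => f (Function.update x t (x t + x c)) := by
  refine Matrix.ext_of_mulVec_single fun y => ?_
  rw [← Matrix.mulVec_mulVec, ← Matrix.mulVec_mulVec]
  funext x
  rw [cnot_mulVec, mulVec_diagonal, cnot_mulVec, mulVec_diagonal,
    ← (eq_update_add_iff hct _ x).1 rfl]

/-- The sign `(-1)^b` of a bit. -/
def bitSign (b : Fin 2) : ℝ := if b = 0 then 1 else -1

/-- The character `x ↦ (-1)^(∑ i ∈ S, x i)` of the group of bit strings. -/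
noncomputable def parity (S : Finset (Fin n)) (x : Basis n) : ℝ := ∏ i ∈ S, bitSign (x i)

lemma bitSign_add (a b : Fin 2) : bitSign (a + b) = bitSign a * bitSign b := by
  fin_cases a <;> fin_cases b <;> simp [bitSign]

lemma parity_update_cnot {T : Finset (Fin n)} {c t : Fin n} (hct : c ≠ t) (ht : t ∉ T)
    (hc : c ∉ T) (x : Basis n) :
    parity (insert t T) (Function.update x t (x t + x c)) = parity (insert t (insert c T)) x := by
  have h : t ∉ insert c T := by simp [ht, hct.symm]
  unfold parity
  rw [Finset.prod_insert ht, Finset.prod_insert h, Finset.prod_insert hc]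
  have h2 : ∏ i ∈ T, bitSign (Function.update x t (x t + x c) i) = ∏ i ∈ T, bitSign (x i) := by
    refine Finset.prod_congr rfl fun i hi => ?_
    rw [Function.update_of_ne]
    rintro rfl
    exact ht hi
  rw [h2, Function.update_self, bitSign_add, mul_assoc]

/-- Conjugation with CNOTs onto the target `t` accumulates the parity of a set of bits in `t`,
where a single-qubit phase gate can read it off. -/
lemma implementable_parityPhase (f : ℝ → ℂ) (hf : ∀ r, ‖f r‖ = 1) (t : Fin n)
    (T : Finset (Fin n)) (ht : t ∉ T) :
    Implementable (2 * T.card + 1) (diagonal fun x => f (parity (insert t T) x)) := by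
  induction T using Finset.induction with
  | empty =>
    have := Implementable.gate (Gate.single t (diagUnitary (fun b => f (bitSign b))
      fun b => hf _))
    rw [single_diagUnitary] at this
    simpa [parity] using this
  | insert c T hc ih =>
    have hct : c ≠ t := by rintro rfl; simp at ht
    have ht' : t ∉ T := fun h => ht (Finset.mem_insert_of_mem h)
    have h := ((Implementable.gate (Gate.cnot c t hct)).mul (ih ht')).mul
      (Implementable.gate (Gate.cnot c t hct))
    rw [cnot_mul_diagonal_mul_cnot] at h
    simp only [parity_update_cnot hct ht' hc] at h
    refine h.mono ?_
    rw [Finset.card_insert_of_notMem hc]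
    omega

lemma implementable_parityPhase_le (hn : 0 < n) (f : ℝ → ℂ) (hf : ∀ r, ‖f r‖ = 1)
    (S : Finset (Fin n)) :
    Implementable (2 * n + 1) (diagonal fun x => f (parity S x)) := by
  rcases S.eq_empty_or_nonempty with rfl | ⟨t, ht⟩
  · have := Implementable.gate (Gate.single (⟨0, hn⟩ : Fin n) (diagUnitary (fun _ => f 1)
      fun b => hf _))
    rw [single_diagUnitary] at this
    simpa [parity] using this.mono (by omega : 1 ≤ 2 * n + 1)
  · have h := implementable_parityPhase f hf t (S.erase t) (Finset.notMem_erase t S)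
    rw [Finset.insert_erase ht] at h
    refine h.mono ?_
    have := Finset.card_le_univ (S.erase t)
    simp only [Fintype.card_fin] at this
    omega

/-- Orthogonality of the characters of the group of bit strings. -/
lemma sum_parity_mul_parity (x y : Basis n) :
    ∑ S, parity S x * parity S y = if x = y then 2 ^ n else 0 := by
  have h : ∑ S, parity S x * parity S y = ∏ i, (1 + bitSign (x i) * bitSign (y i)) := by
    rw [Finset.prod_one_add, Finset.powerset_univ]
    simp only [parity, Finset.prod_mul_distrib]
  rw [h]
  split_ifs with hxy
  · subst hxy
    have : ∀ b : Fin 2, 1 + bitSign b * bitSign b = 2 := by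
      intro b; unfold bitSign; split_ifs <;> norm_num
    simp [this]
  · obtain ⟨i, hi⟩ := Function.ne_iff.1 hxy
    refine Finset.prod_eq_zero (Finset.mem_univ i) ?_
    have : ∀ a b : Fin 2, a ≠ b → 1 + bitSign a * bitSign b = 0 := by
      intro a b hab
      fin_cases a <;> fin_cases b <;> simp [bitSign] at hab ⊢
    exact this _ _ hi

lemma exists_parity_expansion (θ : Basis n → ℝ) :
    ∃ a : Finset (Fin n) → ℝ, ∀ x, θ x = ∑ S, a S * parity S x := by
  refine ⟨fun S => (2 ^ n)⁻¹ * ∑ y, θ y * parity S y, fun x => ?_⟩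
  have : ∀ S : Finset (Fin n), ((2 ^ n)⁻¹ * ∑ y, θ y * parity S y) * parity S x =
      (2 ^ n : ℝ)⁻¹ * ∑ y, θ y * (parity S y * parity S x) := fun S => by
    rw [mul_assoc, Finset.sum_mul]
    simp only [mul_assoc]
  simp only [this]
  rw [← Finset.mul_sum, Finset.sum_comm]
  simp only [← Finset.mul_sum, sum_parity_mul_parity]
  simp
  field_simp

/-- The number of gates that suffice for a diagonal unitary. -/
abbrev diagCost (n : ℕ) : ℕ := 2 ^ n * (2 * n + 1)

/-- Every diagonal unitary is a product of `2 ^ n` parity phases, one for each character in the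
expansion of the exponents. -/
lemma implementable_diagonal (hn : 0 < n) (θ : Basis n → ℝ) :
    Implementable (diagCost n) (diagonal fun x => Complex.exp (θ x * Complex.I)) := by
  obtain ⟨a, ha⟩ := exists_parity_expansion θ
  have key : ∀ s : Finset (Finset (Fin n)), Implementable (s.card * (2 * n + 1))
      (diagonal fun x => Complex.exp ((∑ S ∈ s, a S * parity S x : ℝ) * Complex.I)) := by
    intro s
    induction s using Finset.induction with
    | empty => simpa using Implementable.one
    | insert S s hS ih =>
      have h := (implementable_parityPhase_le hn
        (fun r => Complex.exp ((a S * r : ℝ) * Complex.I))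
        (fun r => Complex.norm_exp_ofReal_mul_I _) S).mul ih
      rw [diagonal_mul_diagonal] at h
      rw [Finset.card_insert_of_notMem hS]
      convert h using 1
      · ring
      · congr 1
        funext x
        rw [Finset.sum_insert hS, ← Complex.exp_add]
        push_cast
        ring_nf
  simpa [ha] using key Finset.univ

/-- Some diagonal circuit removes the phases of all coordinates of a vector. -/
lemma exists_implementable_mulVec_eq_norm (hn : 0 < n) (v : Basis n → ℂ) :
    ∃ M, Implementable (diagCost n) M ∧ M *ᵥ v = fun x => (‖v x‖ : ℂ) := by
  refine ⟨_, implementable_diagonal hn fun x => -(v x).arg, ?_⟩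
  funext x
  rw [mulVec_diagonal]
  nth_rw 2 [← Complex.norm_mul_exp_arg_mul_I (v x)]
  rw [mul_left_comm, ← Complex.exp_add]
  simp

/-! ### State preparation -/

lemma inv_sqrt_two_mul_self : (((√2 : ℝ) : ℂ)⁻¹) * (((√2 : ℝ) : ℂ)⁻¹) = 1 / 2 := by
  rw [← mul_inv, ← Complex.ofReal_mul, Real.mul_self_sqrt (by norm_num)]
  norm_num

/-- The Hadamard gate. -/
noncomputable def hadamard : Matrix.unitaryGroup (Fin 2) ℂ :=
  ⟨((√2 : ℝ) : ℂ)⁻¹ • !![1, 1; 1, -1], by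
    rw [Matrix.mem_unitaryGroup_iff']
    ext i j
    have h := inv_sqrt_two_mul_self
    fin_cases i <;> fin_cases j <;>
      simp [Matrix.mul_apply, Fin.sum_univ_two, Matrix.star_apply] <;> grind⟩

/-- The single-qubit unitary that diagonalizes the plane rotations: it maps a real vector `(a, b)`
to `(a - i b, a + i b) / √2`, a vector with two coordinates of equal modulus. -/
noncomputable def rotationBasis : Matrix.unitaryGroup (Fin 2) ℂ :=
  ⟨((√2 : ℝ) : ℂ)⁻¹ • !![1, -Complex.I; 1, Complex.I], by
    rw [Matrix.mem_unitaryGroup_iff']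
    ext i j
    have h := inv_sqrt_two_mul_self
    have hI := Complex.I_mul_I
    fin_cases i <;> fin_cases j <;>
      simp [Matrix.mul_apply, Fin.sum_univ_two, Matrix.star_apply] <;> grind⟩

/-- For a real vector, all pairs of coordinates that differ in bit `q` only can be rotated to
`(r, 0)` at once: `rotationBasis` makes the two moduli equal, a diagonal unitary makes the two
coordinates equal, and the Hadamard gate cancels the second one. -/
lemma exists_implementable_clear_bit (hn : 0 < n) (q : Fin n) (w : Basis n → ℝ) :
    ∃ (M : Matrix (Basis n) (Basis n) ℂ) (w' : Basis n → ℝ), Implementable (diagCost n + 2) M ∧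
      (M *ᵥ fun x => (w x : ℂ)) = (fun x => (w' x : ℂ)) ∧ (∀ x, x q ≠ 0 → w' x = 0) ∧
      ∀ j, j ≠ q → (∀ x, x j ≠ 0 → w x = 0) → ∀ x, x j ≠ 0 → w' x = 0 := by
  obtain ⟨D, hD, hDv⟩ := exists_implementable_mulVec_eq_norm hn
    ((Gate.single q rotationBasis).toMatrix *ᵥ fun x => (w x : ℂ))
  set r : Basis n → ℝ := fun x =>
    ‖(w (Function.update x q 0) : ℂ) + w (Function.update x q 1) * Complex.I‖ with hr
  have hnorm : ∀ x, ‖((Gate.single q rotationBasis).toMatrix *ᵥ fun x => (w x : ℂ)) x‖ =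
      (√2)⁻¹ * r x := by
    intro x
    rw [single_mulVec, Fin.sum_univ_two]
    have hc : ‖((√2 : ℝ) : ℂ)⁻¹‖ = (√2)⁻¹ := by
      rw [norm_inv, Complex.norm_real, Real.norm_of_nonneg (Real.sqrt_nonneg 2)]
    obtain h | h : x q = 0 ∨ x q = 1 := by omega
    · have hr' : r x = ‖(starRingEnd ℂ) ((w (Function.update x q 0) : ℂ) +
          w (Function.update x q 1) * Complex.I)‖ := (Complex.norm_conj _).symm
      rw [h, hr', ← hc, ← norm_mul]
      congr 1
      simp [rotationBasis]
      ring
    · rw [h, ← hc, ← norm_mul]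
      congr 1
      simp [rotationBasis]
      ring
  have hupd : ∀ x b, r (Function.update x q b) = r x := by
    intro x b
    simp [hr]
  refine ⟨(Gate.single q hadamard).toMatrix * (D * (Gate.single q rotationBasis).toMatrix),
    fun x => if x q = 0 then r x else 0, ?_, ?_, ?_, ?_⟩
  · exact ((Implementable.gate _).mul (hD.mul (.gate _))).mono (by omega)
  · rw [← Matrix.mulVec_mulVec, ← Matrix.mulVec_mulVec, hDv]
    funext x
    rw [single_mulVec, Fin.sum_univ_two, hnorm, hnorm, hupd, hupd]
    have h2 := inv_sqrt_two_mul_self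
    obtain h | h : x q = 0 ∨ x q = 1 := by omega
    · simp [h, hadamard]
      grind
    · simp [h, hadamard]
  · intro x hx
    simp [hx]
  · intro j hj hw x hx
    have : ∀ b, w (Function.update x q b) = 0 := fun b => hw _ (by simpa [hj] using hx)
    simp [hr, this]

/-- The number of gates that suffice to map a given state to a basis state. -/
abbrev prepCost (n : ℕ) : ℕ := diagCost n + n * (diagCost n + 2)

/-- Every state is mapped to a multiple of `|0⟩` by a circuit, which clears one bit after
another. -/
lemma exists_implementable_mulVec_eq_single (hn : 0 < n) (v : Basis n → ℂ) :
    ∃ M, Implementable (prepCost n) M ∧ ∃ r : ℂ, M *ᵥ v = Pi.single 0 r := by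
  have key : ∀ S : Finset (Fin n), ∃ (M : Matrix (Basis n) (Basis n) ℂ) (w : Basis n → ℝ),
      Implementable (diagCost n + S.card * (diagCost n + 2)) M ∧
      M *ᵥ v = (fun x => (w x : ℂ)) ∧ ∀ j ∈ S, ∀ x, x j ≠ 0 → w x = 0 := by
    intro S
    induction S using Finset.induction with
    | empty =>
      obtain ⟨M, hM, h⟩ := exists_implementable_mulVec_eq_norm hn v
      exact ⟨M, fun x => ‖v x‖, by simpa using hM, h, by simp⟩
    | insert q S hq ih =>
      obtain ⟨M, w, hM, hv, hw⟩ := ih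
      obtain ⟨M', w', hM', hv', hq', hw'⟩ := exists_implementable_clear_bit hn q w
      refine ⟨M' * M, w', (hM'.mul hM).mono ?_, ?_, ?_⟩
      · rw [Finset.card_insert_of_notMem hq]
        exact le_of_eq (by ring)
      · rw [← Matrix.mulVec_mulVec, hv, hv']
      · intro j hj
        obtain rfl | hj := Finset.mem_insert.1 hj
        · exact hq'
        · exact hw' j (fun h => hq (h ▸ hj)) (hw j hj)
  obtain ⟨M, w, hM, hv, hw⟩ := key Finset.univ
  refine ⟨M, by simpa using hM, w 0, ?_⟩
  rw [hv]
  funext x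
  by_cases hx : x = 0
  · subst hx; simp
  · obtain ⟨j, hj⟩ := Function.ne_iff.1 hx
    simp [Pi.single_eq_of_ne hx, hw j (Finset.mem_univ j) x hj]

/-! ### Phases on orthonormal vectors -/

/-- The number of gates that suffice for a phase on a one-dimensional subspace. -/
abbrev phaseCost (n : ℕ) : ℕ := 2 * prepCost n + diagCost n

/-- The unitary that multiplies the unit vector `v` by the phase `e^{iθ}` and fixes its orthogonal
complement: map `v` to `|0⟩`, apply a phase there, and go back. -/
lemma implementable_rankOne (hn : 0 < n) (v : Basis n → ℂ) (hv : star v ⬝ᵥ v = 1) (θ : ℝ) :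
    Implementable (phaseCost n)
      (1 + (Complex.exp (θ * Complex.I) - 1) • vecMulVec v (star v)) := by
  obtain ⟨M, hM, r, hr⟩ := exists_implementable_mulVec_eq_single hn v
  obtain ⟨hMM, hM'⟩ := hM.adjoint
  have hMM' : M * Mᴴ = 1 := mul_eq_one_comm.1 hMM
  have hrr : r * star r = 1 := by
    have h : star (M *ᵥ v) ⬝ᵥ (M *ᵥ v) = 1 := by
      rw [star_mulVec, ← dotProduct_mulVec, mulVec_mulVec, hMM, one_mulVec, hv]
    rw [hr] at h
    simpa [mul_comm] using h
  have hD := implementable_diagonal hn (Pi.single 0 θ)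
  have hproj : M * vecMulVec v (star v) * Mᴴ = diagonal (Pi.single 0 1) := by
    rw [Matrix.mul_vecMulVec, Matrix.vecMulVec_mul, ← star_mulVec, hr]
    ext x y
    by_cases hx : x = 0 <;> by_cases hy : y = 0 <;> by_cases hxy : x = y <;>
      simp_all [vecMulVec_apply]
  have hdiag : (diagonal fun x => Complex.exp ((Pi.single 0 θ : Basis n → ℝ) x * Complex.I)) =
      1 + (Complex.exp (θ * Complex.I) - 1) • (diagonal (Pi.single (0 : Basis n) (1 : ℂ))) := by
    rw [← diagonal_one, ← diagonal_smul, diagonal_add]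
    congr 1
    funext x
    by_cases hx : x = 0 <;> simp [hx]
  rw [hdiag, ← hproj] at hD
  convert ((hM'.mul hD).mul hM).mono (l := phaseCost n) (by unfold phaseCost; omega) using 1
  have : vecMulVec v (star v) = Mᴴ * (M * vecMulVec v (star v) * Mᴴ) * M := by
    simp only [Matrix.mul_assoc, hMM]
    rw [Matrix.mul_one, ← Matrix.mul_assoc, hMM, Matrix.one_mul]
  rw [Matrix.mul_add, Matrix.add_mul, Matrix.mul_one, hMM, Matrix.mul_smul, Matrix.smul_mul,
    ← this]

/-- The columns of the isometry `F` are multiplied by phases, one after another. -/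
lemma implementable_isometry_diagonal {V : Type*} [Fintype V] [DecidableEq V] (hn : 0 < n)
    (F : Matrix (Basis n) V ℂ) (hF : Fᴴ * F = 1) (θ : V → ℝ) :
    Implementable (Fintype.card V * phaseCost n)
      (1 + F * (diagonal fun j => Complex.exp (θ j * Complex.I) - 1) * Fᴴ) := by
  have key : ∀ T : Finset V, Implementable (T.card * phaseCost n)
      (1 + F * (diagonal fun j => if j ∈ T then Complex.exp (θ j * Complex.I) - 1 else 0)
        * Fᴴ) := by
    intro T
    induction T using Finset.induction with
    | empty => simpa using Implementable.one
    | insert i T hi ih =>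
      have hcol : star (F.col i) ⬝ᵥ F.col i = 1 := by
        have := congrFun (congrFun hF i) i
        simpa [Matrix.mul_apply, dotProduct] using this
      have h1 := implementable_rankOne hn (F.col i) hcol (θ i)
      have h2 : vecMulVec (F.col i) (star (F.col i)) = F * diagonal (Pi.single i (1 : ℂ)) * Fᴴ := by
        ext x y
        simp [vecMulVec_apply, Matrix.mul_apply, Pi.single_apply, diagonal_apply]
      have h3 := h1.mul ih
      rw [Finset.card_insert_of_notMem hi, add_mul, one_mul, add_comm]
      convert h3 using 1
      rw [h2, Matrix.add_mul, Matrix.one_mul, Matrix.mul_add, Matrix.mul_one, Matrix.smul_mul]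
      -- `i ∉ T`, so the phases already applied and the new one act on orthogonal columns.
      have h4 : F * diagonal (Pi.single i (1 : ℂ)) * Fᴴ * (F * (diagonal fun j =>
          if j ∈ T then Complex.exp (θ j * Complex.I) - 1 else 0) * Fᴴ) = 0 := by
        have h5 : ∀ A B : Matrix V V ℂ, F * A * Fᴴ * (F * B * Fᴴ) = F * (A * B) * Fᴴ := by
          intro A B
          calc F * A * Fᴴ * (F * B * Fᴴ) = F * A * (Fᴴ * F) * B * Fᴴ := by
                simp only [Matrix.mul_assoc]
            _ = F * (A * B) * Fᴴ := by rw [hF, Matrix.mul_one, Matrix.mul_assoc F]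
        have h6 : (diagonal fun j => (Pi.single i (1 : ℂ) : V → ℂ) j *
            if j ∈ T then Complex.exp (θ j * Complex.I) - 1 else 0) = 0 := by
          rw [diagonal_eq_zero]
          funext j
          by_cases hj : j = i
          · subst hj; simp [hi]
          · simp [hj]
        rw [h5, diagonal_mul_diagonal, h6, Matrix.mul_zero, Matrix.zero_mul]
      rw [h4, smul_zero, add_zero, add_assoc, ← Matrix.smul_mul, ← Matrix.mul_smul,
        ← Matrix.add_mul, ← Matrix.mul_add, ← diagonal_smul, diagonal_add]
      congr 5
      funext j
      by_cases hj : j = i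
      · subst hj; simp [hi]
      · simp [hj]
  simpa using key Finset.univ

/-! ### The walk operator -/

lemma encode_conjTranspose_mul_encode {V : Type*} [Fintype V] [DecidableEq V] (e : V ↪ Basis n) :
    (encode e)ᴴ * encode e = 1 := by
  ext i j
  simp [encode, Matrix.mul_apply, Matrix.one_apply]
  exact if_congr eq_comm rfl rfl

/-- Spectral decomposition of the walk operator. The Laplacian is diagonalized over `ℝ`. -/
lemma exists_walk_eq {V : Type*} [Fintype V] [DecidableEq V] (G : SimpleGraph V)
    [DecidableRel G.Adj] :
    ∃ (U : Matrix V V ℂ) (μ : V → ℝ), Uᴴ * U = 1 ∧ U * Uᴴ = 1 ∧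
      (∀ j, 0 ≤ μ j ∧ Module.End.HasEigenvalue (Matrix.toLin' (G.lapMatrix ℝ)) (μ j)) ∧
      ∀ t : ℝ, walk G t =
        U * (diagonal fun j => Complex.exp ((t * μ j : ℝ) * Complex.I)) * Uᴴ := by
  have hL := G.posSemidef_lapMatrix ℝ
  set h := hL.isHermitian
  set R : Matrix V V ℝ := h.eigenvectorUnitary.1
  set U : Matrix V V ℂ := R.map Complex.ofRealHom with hU
  have hstar : Uᴴ = Rᴴ.map Complex.ofRealHom := by ext; simp [hU]
  have hUU : Uᴴ * U = 1 := by
    have h1 : Rᴴ * R = 1 := Unitary.coe_star_mul_self h.eigenvectorUnitary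
    rw [hstar, hU, ← Matrix.map_mul, h1, Matrix.map_one _ (by simp) (by simp)]
  have hUU' : U * Uᴴ = 1 := mul_eq_one_comm.1 hUU
  refine ⟨U, h.eigenvalues, hUU, hUU', fun j => ⟨hL.eigenvalues_nonneg j, ?_⟩, fun t => ?_⟩
  · refine Module.End.hasEigenvalue_of_hasEigenvector
      (x := ⇑(h.eigenvectorBasis j)) ⟨?_, ?_⟩
    · rw [Module.End.mem_eigenspace_iff, toLin'_apply, h.mulVec_eigenvectorBasis]
    · intro h0
      refine h.eigenvectorBasis.orthonormal.ne_zero j ?_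
      ext i
      exact congrFun h0 i
  · have hdec : G.lapMatrix ℂ = U * (diagonal fun j => (h.eigenvalues j : ℂ)) * Uᴴ := by
      have h1 : G.lapMatrix ℝ = R * diagonal h.eigenvalues * Rᴴ := by
        have := h.spectral_theorem
        rw [Unitary.conjStarAlgAut_apply] at this
        exact this
      have h2 : G.lapMatrix ℂ = (G.lapMatrix ℝ).map Complex.ofRealHom := by
        ext i j
        simp [SimpleGraph.lapMatrix, SimpleGraph.degMatrix, SimpleGraph.adjMatrix_apply,
          diagonal_apply, apply_ite Complex.ofReal]
      refine h2.trans ((congrArg (fun M => M.map Complex.ofRealHom) h1).trans ?_)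
      rw [Matrix.map_mul, Matrix.map_mul, hstar, diagonal_map (by simp)]
      rfl
    have hinv : U⁻¹ = Uᴴ := inv_eq_left_inv hUU
    rw [walk, hdec, ← Matrix.smul_mul, ← Matrix.mul_smul, ← hinv,
      Matrix.exp_conj _ _ ((Matrix.isUnit_iff_isUnit_det U).2
        (Matrix.isUnit_det_of_left_inverse hUU)), ← diagonal_smul, Matrix.exp_diagonal]
    congr 3
    funext j
    rw [Pi.coe_exp, ← Complex.exp_eq_exp_ℂ]
    simp
    ring_nf

open scoped Matrix.Norms.L2Operator in
lemma norm_le_one_of_conjTranspose_mul_self {m V : Type*} [Fintype m] [Fintype V]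
    [DecidableEq V] (F : Matrix m V ℂ) (hF : Fᴴ * F = 1) : ‖F‖ ≤ 1 := by
  have h1 := l2_opNorm_conjTranspose_mul_self F
  rw [hF, ← diagonal_one, l2_opNorm_diagonal] at h1
  have h2 : ‖(fun _ => 1 : V → ℂ)‖ ≤ 1 := (pi_norm_le_iff_of_nonneg zero_le_one).2 (by simp)
  nlinarith [norm_nonneg F]

open scoped Matrix.Norms.L2Operator in
/-- For short times the walk operator is close to the identity. -/
lemma simulates_nil {V : Type*} [Fintype V] [DecidableEq V] (G : SimpleGraph V)
    [DecidableRel G.Adj] {lam : ℝ}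
    (hlam : IsGreatest {μ : ℝ | Module.End.HasEigenvalue (Matrix.toLin' (G.lapMatrix ℝ)) μ} lam)
    (e : V ↪ Basis n) {t : ℝ} (ht : 0 ≤ t) : Simulates e [] (walk G t) (lam * t) := by
  obtain ⟨U, μ, hU, hU', hμ, hw⟩ := exists_walk_eq G
  have hfac : Circuit.toMatrix ([] : Circuit n) * encode e - encode e * walk G t =
      (encode e * U) *
        (diagonal fun j => 1 - Complex.exp ((t * μ j : ℝ) * Complex.I)) * Uᴴ := by
    rw [hw, ← diagonal_sub, diagonal_one]
    simp only [Circuit.toMatrix, Matrix.mul_sub, Matrix.sub_mul, Matrix.mul_assoc, Matrix.one_mul,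
      Matrix.mul_one, hU']
  have hlam0 : 0 ≤ lam * t := by
    obtain ⟨v, hv⟩ := hlam.1.exists_hasEigenvector
    have : Nonempty V := by
      by_contra hV
      rw [not_nonempty_iff] at hV
      exact hv.2 (Subsingleton.elim _ _)
    have j : V := Classical.arbitrary V
    exact mul_nonneg ((hμ j).1.trans (hlam.2 (hμ j).2)) ht
  change ‖Circuit.toMatrix ([] : Circuit n) * encode e - encode e * walk G t‖ ≤ lam * t
  rw [hfac]
  have hEU : ‖encode e * U‖ ≤ 1 := norm_le_one_of_conjTranspose_mul_self _ (by
    rw [conjTranspose_mul, Matrix.mul_assoc, ← Matrix.mul_assoc _ _ U,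
      encode_conjTranspose_mul_encode, Matrix.one_mul, hU])
  have hUs : ‖Uᴴ‖ ≤ 1 := norm_le_one_of_conjTranspose_mul_self _ (by rw [conjTranspose_conjTranspose, hU'])
  have hD : ‖diagonal fun j => 1 - Complex.exp ((t * μ j : ℝ) * Complex.I)‖ ≤ lam * t := by
    rw [l2_opNorm_diagonal, pi_norm_le_iff_of_nonneg hlam0]
    intro j
    rw [norm_sub_rev, mul_comm _ Complex.I]
    refine Real.norm_exp_I_mul_ofReal_sub_one_le.trans ?_
    rw [Real.norm_of_nonneg (mul_nonneg ht (hμ j).1), mul_comm]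
    exact mul_le_mul_of_nonneg_right (hlam.2 (hμ j).2) ht
  calc _ ≤ ‖encode e * U‖ * ‖diagonal fun j => 1 - Complex.exp ((t * μ j : ℝ) * Complex.I)‖
        * ‖Uᴴ‖ := (l2_opNorm_mul _ _).trans
          (mul_le_mul_of_nonneg_right (l2_opNorm_mul _ _) (norm_nonneg _))
    _ ≤ 1 * (lam * t) * 1 := by gcongr
    _ = lam * t := by ring

/-- The walk operator is implemented exactly, for every time `t`. -/
lemma exists_simulates_exact {V : Type*} [Fintype V] [DecidableEq V] (hn : 0 < n)
    (G : SimpleGraph V) [DecidableRel G.Adj] (e : V ↪ Basis n) (t : ℝ) :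
    ∃ c : Circuit n, Simulates e c (walk G t) 0 ∧ c.length ≤ Fintype.card V * phaseCost n := by
  obtain ⟨U, μ, hU, hU', -, hw⟩ := exists_walk_eq G
  have hE := encode_conjTranspose_mul_encode e
  obtain ⟨c, hc, hlen⟩ := implementable_isometry_diagonal hn (encode e * U) (by
    rw [conjTranspose_mul, Matrix.mul_assoc, ← Matrix.mul_assoc _ _ U, hE, Matrix.one_mul, hU])
    (fun j => t * μ j)
  refine ⟨c, ?_, hlen⟩
  have : Circuit.toMatrix c * encode e - encode e * walk G t = 0 := by
    rw [hc, hw, ← diagonal_sub, diagonal_one]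
    simp only [conjTranspose_mul, Matrix.mul_sub, Matrix.sub_mul, Matrix.mul_assoc, Matrix.one_mul,
      Matrix.mul_one, Matrix.add_mul, hE, hU']
    abel
  rw [Simulates, this, specNorm]
  simp

/-! ### Gate count -/

lemma phaseCost_le (hn : 0 < n) : phaseCost n ≤ 19 * (n * n * 2 ^ n) := by
  obtain ⟨m, rfl⟩ : ∃ m, n = m + 1 := ⟨n - 1, by omega⟩
  have h : 1 ≤ 2 ^ m := Nat.one_le_two_pow
  simp only [phaseCost, prepCost, diagCost, pow_succ]
  nlinarith [Nat.zero_le m, mul_le_mul h (le_refl m) (Nat.zero_le _) (Nat.zero_le _),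
    Nat.zero_le (2 ^ m * m), Nat.zero_le (2 ^ m * m * m)]

lemma card_mul_phaseCost_le {N : ℕ} (hN : 2 ≤ N) :
    ((N * phaseCost (Nat.clog 2 N) : ℕ) : ℝ) ≤ 304 * ((N : ℝ) ^ 4 * Real.log N) := by
  set n := Nat.clog 2 N with hn
  have hn0 : 0 < n := Nat.clog_pos one_lt_two hN
  -- `n` is the least exponent with `N ≤ 2 ^ n`, so `2 ^ (n - 1) < N`.
  have h1 : 2 ^ n ≤ 2 * N := by
    have := Nat.pow_pred_clog_lt_self one_lt_two (by omega : 1 < N)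
    rw [← hn] at this
    have h : 2 ^ n = 2 * 2 ^ n.pred := by
      rw [← pow_succ', Nat.pred_eq_sub_one, Nat.sub_add_cancel hn0]
    omega
  have h2 : n ≤ 2 * N := n.lt_two_pow_self.le.trans h1
  have hN' : (2 : ℝ) ≤ N := by exact_mod_cast hN
  have h3 : (n : ℝ) ≤ 4 * Real.log N := by
    -- `2 ^ n ≤ 2 N ≤ N ^ 2`, where the last step uses `2 ≤ N`.
    have h : ((2 : ℝ) ^ n) ≤ (N : ℝ) ^ 2 := by
      have : (2 : ℝ) ^ n ≤ 2 * N := by exact_mod_cast h1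
      nlinarith
    have hlog := Real.log_le_log (by positivity) h
    rw [Real.log_pow, Real.log_pow] at hlog
    push_cast at hlog
    nlinarith [Real.log_two_gt_d9, (Nat.cast_nonneg n : (0 : ℝ) ≤ n)]
  have h4 : N * phaseCost n ≤ 76 * (N ^ 3 * n) := by
    calc N * phaseCost n ≤ N * (19 * (n * n * 2 ^ n)) := by gcongr; exact phaseCost_le hn0
      _ ≤ N * (19 * (n * (2 * N) * (2 * N))) := by gcongr
      _ = _ := by ring
  have hlog0 : 0 ≤ Real.log N := Real.log_nonneg (by linarith)
  calc ((N * phaseCost n : ℕ) : ℝ) ≤ 76 * ((N : ℝ) ^ 3 * n) := by exact_mod_cast h4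
    _ ≤ 76 * ((N : ℝ) ^ 4 * (4 * Real.log N)) := by
      gcongr
      · linarith
      · norm_num
    _ = _ := by ring

/-- A graph with at most one vertex has zero Laplacian. -/
lemma two_le_card {V : Type*} [Fintype V] [DecidableEq V] (G : SimpleGraph V)
    [DecidableRel G.Adj] {lam : ℝ} (hlam0 : lam ≠ 0)
    (hlam : Module.End.HasEigenvalue (Matrix.toLin' (G.lapMatrix ℝ)) lam) :
    2 ≤ Fintype.card V := by
  by_contra! hlt
  have : Subsingleton V := Fintype.card_le_one_iff_subsingleton.1 (by omega)
  obtain ⟨v, hv⟩ := hlam.exists_hasEigenvector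
  have h := hv.apply_eq_smul
  rw [toLin'_apply, (SimpleGraph.lapMatrix_mulVec_eq_zero_iff_forall_adj G).2
    fun i j _ => congrArg v (Subsingleton.elim i j)] at h
  exact (smul_ne_zero hlam0 hv.2) h.symm

end CTQW

theorem corollary1 (ε : ℝ) (hε : 0 < ε) :
    ∃ C : ℝ, 0 < C ∧
      ∀ (V : Type*) [Fintype V] [DecidableEq V] (G : SimpleGraph V) [DecidableRel G.Adj]
        (lam : ℝ),
        IsGreatest {μ : ℝ | Module.End.HasEigenvalue (Matrix.toLin' (G.lapMatrix ℝ)) μ} lam →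
        ∀ (e : V ↪ CTQW.Basis (Nat.clog 2 (Fintype.card V))) (t : ℝ), 0 ≤ t →
          ∃ c : CTQW.Circuit (Nat.clog 2 (Fintype.card V)),
            CTQW.Simulates e c (CTQW.walk G t) ε ∧
            (c.length : ℝ) ≤
              C * (lam * t * (Fintype.card V : ℝ) ^ 4 * Real.log (Fintype.card V)) := by
  refine ⟨304 / ε, by positivity, fun V _ _ G _ lam hlam e t ht => ?_⟩
  have hnil := CTQW.simulates_nil G hlam e ht
  have hlog0 : 0 ≤ Real.log (Fintype.card V) := Real.log_natCast_nonneg _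
  -- For `N = 1` the bound is zero; then `λ = 0`, and the empty circuit is exact.
  rcases le_or_gt (lam * t) ε with h | h
  · refine ⟨[], hnil.trans h, ?_⟩
    have hlt : 0 ≤ lam * t := (norm_nonneg _).trans hnil
    simp only [List.length_nil, Nat.cast_zero]
    positivity
  · have hlam0 : lam ≠ 0 := by
      rintro rfl
      rw [zero_mul] at h
      exact hε.not_gt h
    have hN := CTQW.two_le_card G hlam0 hlam.1
    obtain ⟨c, hc, hlen⟩ := CTQW.exists_simulates_exact
      (Nat.clog_pos one_lt_two hN) G e t
    refine ⟨c, hc.trans hε.le, ?_⟩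
    have hB : 0 ≤ 304 * ((Fintype.card V : ℝ) ^ 4 * Real.log (Fintype.card V)) := by positivity
    calc (c.length : ℝ) ≤ _ := Nat.cast_le.2 hlen
      _ ≤ 304 * ((Fintype.card V : ℝ) ^ 4 * Real.log (Fintype.card V)) :=
        CTQW.card_mul_phaseCost_le hN
      _ ≤ 304 * ((Fintype.card V : ℝ) ^ 4 * Real.log (Fintype.card V)) * (lam * t / ε) :=
        le_mul_of_one_le_right hB ((one_le_div hε).2 h.le)
      _ = _ := by ring
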